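/- Fix a first-order language $\mathcal L$ with equality and with an infinite set $\mathit{Var}$ of variables. Expressions are terms of $\mathcal L$, Boolean expressions are quantifier-free formulas, assertions are formulas. Statements are given by $$S ::= skip \mid \bar x:=\bar t \mid P(\bar t) \mid S;S \mid \mathbf{if}\ B\ \mathbf{then}\ S\ \mathbf{else}\ S\ \mathbf{fi} \mid \mathbf{while}\ B\ \mathbf{do}\ S\ \mathbf{od} \mid \mathbf{begin\ local}\ \bar x:=\bar t;\ S\ \mathbf{end},$$ where $\bar x$ is a finite list of distinct variables and $\bar t$ a list of expressions of the same length. Fix a finite set $D=\{P_i(\bar u_i)::S_i \mid 1\le i\le n\}$ of (mutually recursive) procedure declarations, one for each procedure name, where the formal parameters $\bar u_i$ are distinct variables; calls have as many actual as formal parameters. Let $I$ be an interpretation of $\mathcal L$ with non-empty domain; a state $\sigma$ maps variables to domain elements. The meaning of a program $(D\mid S)$ is the usual input-output relation on states, where $\mathbf{begin\ local}\ \bar x:=\bar t;\ S\ \mathbf{end}$, started in $\sigma$, executes $\bar x:=\bar t;\ S$ and, on termination, resets $\bar x$ to $\sigma(\bar x)$, and a call $P(\bar t)$ with $P(\bar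 u)::S\in D$ is executed as $\mathbf{begin\ local}\ \bar u:=\bar t;\ S\ \mathbf{end}$. Let $sp_I(p,S)$ be the set of final states of executions of $(D\mid S)$ from states satisfying $p$. Write $I\models\{p\}S\{q\}$ if every state in $sp_I(p,S)$ satisfies $q$. Call $\mathcal L$ expressive relative to $I$ (for $D$) if for every assertion $p$ and statement $S$ some formula of $\mathcal L$ is true in exactly the states of $sp_I(p,S)$. Let $var(D\mid S)$ be the set of variables occurring in $D$ or $S$. Let $change(D\mid S)$ be defined by: $\emptyset$ for $skip$; $\{\bar x\}$ for $\bar x:=\bar t$; the union over the immediate components for composition, conditional and loop; $change(D\mid S)\setminus\{\bar x\}$ for the block above; and $change(D)\setminus\{\bar u\}$ for a call $P(\bar t)$ with $P(\bar u)::S\in D$. Here $change(D)=\bigcup_i change(\emptyset\mid S_i)$, calls contributing $\emptyset$ to $change(\emptyset\mid\cdot)$. Substitution in assertions is simultaneous and capture-avoiding. The proof system CBV has the following axioms and rules: - SKIP: $\{p\}\,skip\,\{p\}$. - ASSIGNMENT: $\{p[\bar x:=\bar t]\}\ \bar x:=\bar t\ \{p\}$. - COMPOSITION: from $\{p\}S_1\{r\}$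 and $\{r\}S_2\{q\}$ infer $\{p\}S_1;S_2\{q\}$. - CONDITIONAL: from $\{p\wedge B\}S_1\{q\}$ and $\{p\wedge\neg B\}S_2\{q\}$ infer $\{p\}\mathbf{if}\ B\ \mathbf{then}\ S_1\ \mathbf{else}\ S_2\ \mathbf{fi}\{q\}$. - LOOP: from $\{p\wedge B\}S\{p\}$ infer $\{p\}\mathbf{while}\ B\ \mathbf{do}\ S\ \mathbf{od}\{p\wedge\neg B\}$. - BLOCK: from $\{p\}\bar x:=\bar t;S\{q\}$ infer $\{p\}\mathbf{begin\ local}\ \bar x:=\bar t;S\ \mathbf{end}\{q\}$, if $\{\bar x\}\cap free(q)=\emptyset$. - PROCEDURE CALL: from $\{p\}P(\bar u)\{q\}$ infer $\{p[\bar u:=\bar t]\}P(\bar t)\{q\}$, if $P(\bar u)::S\in D$ for some $S$ and $\{\bar u\}\cap free(q)=\emptyset$. - SUBSTITUTION: from $\{p\}S\{q\}$ infer $\{p[\bar x:=\bar y]\}S\{q[\bar x:=\bar y]\}$, for a list $\bar y$ of variables, if $\{\bar x\}\cap var(D\mid S)=\emptyset$ and $\{\bar y\}\cap change(D\mid S)=\emptyset$.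 - INVARIANCE: from $\{r\}S\{q\}$ infer $\{p\wedge r\}S\{p\wedge q\}$, if $free(p)\cap change(D\mid S)=\emptyset$. - $\exists$-INTRODUCTION: from $\{p\}S\{q\}$ infer $\{\exists\bar x:p\}S\{q\}$, if $\{\bar x\}\cap(var(D\mid S)\cup free(q))=\emptyset$. - CONSEQUENCE: from $\{p_1\}S\{q_1\}$ infer $\{p\}S\{q\}$, if $p\to p_1$ and $q_1\to q$ are true in $I$. - RECURSION: infer $\{p\}S\{q\}$ if there are assertions $p_i,q_i$ with $\{\bar u_i\}\cap free(q_i)=\emptyset$ ($1\le i\le n$) such that $\{p\}S\{q\}$ and all $\{p_i\}S_i\{q_i\}$ ($1\le i\le n$) are provable from the assumptions $\{p_1\}P_1(\bar u_1)\{q_1\},\dots,\{p_n\}P_n(\bar u_n)\{q_n\}$ by the other axioms and rules. Write $\vdash_I\{p\}S\{q\}$ if $\{p\}S\{q\}$ is provable in CBV, using the assertions true in $I$ in CONSEQUENCE. **Theorem (Completeness).** CBV is complete in the sense of Cook: for every interpretation $I$ such that $\mathcal L$ is expressive relative to $I$ and every correctness formula $\{p\}S\{q\}$, if $I\models\{p\}S\{q\}$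 then $\vdash_I\{p\}S\{q\}$. -/

import Mathlib

universe u v w x y

namespace CBV

noncomputable section

/-! ### Assertions

Expressions are the terms `L.Term V` of a first-order language `L` (with equality) over the set of
variables `V`, assertions are the formulas `L.Formula V`, and Boolean expressions are the
quantifier-free formulas. Lists of distinct variables are embeddings `Fin n ↪ V`. Bound variables
of Mathlib formulas are nameless, so the elements of `V` that occur in a formula are exactly its
free variables and substitution cannot capture variables. -/

section Assertions

variable {L : FirstOrder.Language.{u, v}} {V : Type w}

/-- `[x̄ := t̄]` as a map from variables to expressions: `x i` goes to `t i`, every other variable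
to itself. -/
def substMap {n : ℕ} (xs : Fin n ↪ V) (t : Fin n → L.Term V) : V → L.Term V :=
  Function.extend xs t FirstOrder.Language.Term.var

/-- The result `p[x̄ := t̄]` of the simultaneous substitution of `t̄` for `x̄` in `p`. -/
def subst {n : ℕ} (p : L.Formula V) (xs : Fin n ↪ V) (t : Fin n → L.Term V) : L.Formula V :=
  FirstOrder.Language.BoundedFormula.subst p (substMap xs t)

/-- The assertion `∃ x̄ : p`. -/
def existsVars {n : ℕ} (xs : Fin n ↪ V) (p : L.Formula V) : L.Formula V :=
  FirstOrder.Language.BoundedFormula.exs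
    (FirstOrder.Language.BoundedFormula.relabel (n := n) (k := 0) (Function.extend xs Sum.inr Sum.inl) p)

/-- `free(p)`. -/
def free [DecidableEq V] (p : L.Formula V) : Set V :=
  ↑(FirstOrder.Language.BoundedFormula.freeVarFinset p)

/-- The variables that occur in a list of expressions. -/
def termVars [DecidableEq V] {n : ℕ} (t : Fin n → L.Term V) : Set V :=
  ⋃ i, ↑(t i).varFinset

end Assertions

/-! ### Programs -/

/-- Statements over procedure names `Proc`, where the procedure `P` has `ar P` parameters. -/
inductive Stmt (L : FirstOrder.Language.{u, v}) (V : Type w) {Proc : Type x} (ar : Proc → ℕ) :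
    Type (max u v w x)
  | skip : Stmt L V ar
  /-- the parallel assignment `x̄ := t̄` -/
  | assign {n : ℕ} (xs : Fin n ↪ V) (t : Fin n → L.Term V) : Stmt L V ar
  /-- the procedure call `P(t̄)` -/
  | call (P : Proc) (t : Fin (ar P) → L.Term V) : Stmt L V ar
  | seq (S₁ S₂ : Stmt L V ar) : Stmt L V ar
  | cond (B : L.Formula V) (hB : FirstOrder.Language.BoundedFormula.IsQF B) (S₁ S₂ : Stmt L V ar) :
      Stmt L V ar
  | loop (B : L.Formula V) (hB : FirstOrder.Language.BoundedFormula.IsQF B) (S : Stmt L V ar) : Stmt L V ar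
  /-- the block statement `begin local x̄ := t̄; S end` -/
  | block {n : ℕ} (xs : Fin n ↪ V) (t : Fin n → L.Term V) (S : Stmt L V ar) : Stmt L V ar

/-- A system of (mutually recursive) procedure declarations, with exactly one declaration
`P(ū) :: S` for every procedure name `P`. -/
structure Decls (L : FirstOrder.Language.{u, v}) (V : Type w) {Proc : Type x} (ar : Proc → ℕ) where
  /-- the formal parameters -/
  formals : (P : Proc) → Fin (ar P) ↪ V
  /-- the procedure bodies -/
  body : Proc → Stmt L V ar

section Programs

variable {L : FirstOrder.Language.{u, v}} {V : Type w} {Proc : Type x} {ar : Proc → ℕ}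

/-- The generic call `P(ū)`, where `ū` are the formal parameters of `P`. -/
def genericCall (D : Decls L V ar) (P : Proc) : Stmt L V ar :=
  Stmt.call P fun i => FirstOrder.Language.Term.var (D.formals P i)

/-- The variables that occur in a statement. -/
def Stmt.vars [DecidableEq V] : Stmt L V ar → Set V
  | .skip => ∅
  | .assign xs t => Set.range xs ∪ termVars t
  | .call _ t => termVars t
  | .seq S₁ S₂ => S₁.vars ∪ S₂.vars
  | .cond B _ S₁ S₂ => free B ∪ S₁.vars ∪ S₂.vars
  | .loop B _ S => free B ∪ S.vars
  | .block xs t S => Set.range xs ∪ termVars t ∪ S.vars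

/-- `var(D | S)`, the set of variables that occur in the program `(D | S)`. -/
def progVars [DecidableEq V] (D : Decls L V ar) (S : Stmt L V ar) : Set V :=
  (⋃ P, Set.range (D.formals P) ∪ (D.body P).vars) ∪ S.vars

/-- The variables that can be changed by a statement, given for each procedure the set of variables
that can be changed by a call of it. -/
def Stmt.changeWith (c : Proc → Set V) : Stmt L V ar → Set V
  | .skip => ∅
  | .assign xs _ => Set.range xs
  | .call P _ => c P
  | .seq S₁ S₂ => S₁.changeWith c ∪ S₂.changeWith c
  | .cond _ _ S₁ S₂ => S₁.changeWith c ∪ S₂.changeWith c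
  | .loop _ _ S => S.changeWith c
  | .block xs _ S => S.changeWith c \ Set.range xs

/-- `change(D)`, the union over all declarations `P(ū) :: S` in `D` of `change(∅ | S)`, in which
procedure calls contribute nothing. -/
def changeDecls (D : Decls L V ar) : Set V :=
  ⋃ P, (D.body P).changeWith fun _ => ∅

/-- `change(D | S)`, where `change(D | P(t̄)) = change(D) \ {ū}` for `P(ū) :: S` in `D`. -/
def change (D : Decls L V ar) (S : Stmt L V ar) : Set V :=
  S.changeWith fun P => changeDecls D \ Set.range (D.formals P)

end Programs

/-! ### Semantics -/

section Semantics

variable {L : FirstOrder.Language.{u, v}} {V : Type w} {Proc : Type x} {ar : Proc → ℕ}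
variable {M : Type y}

/-- The update `σ[x̄ := d̄]` of a state `σ`. -/
def update {n : ℕ} (σ : V → M) (xs : Fin n ↪ V) (d : Fin n → M) : V → M :=
  Function.extend xs d σ

variable [L.Structure M]

/-- `Exec D S σ τ`: the program `(D | S)`, started in the state `σ`, terminates in the state `τ`.
A procedure call is executed as the block that results from inlining. -/
inductive Exec (D : Decls L V ar) : Stmt L V ar → (V → M) → (V → M) → Prop
  | skip (σ : V → M) : Exec D .skip σ σ
  | assign {n : ℕ} (xs : Fin n ↪ V) (t : Fin n → L.Term V) (σ : V → M) :
      Exec D (.assign xs t) σ (update σ xs fun i => (t i).realize σ)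
  | call {P : Proc} {t : Fin (ar P) → L.Term V} {σ τ : V → M} :
      Exec D (.block (D.formals P) t (D.body P)) σ τ → Exec D (.call P t) σ τ
  | seq {S₁ S₂ : Stmt L V ar} {σ ρ τ : V → M} :
      Exec D S₁ σ ρ → Exec D S₂ ρ τ → Exec D (.seq S₁ S₂) σ τ
  | condTrue {B : L.Formula V} {hB : FirstOrder.Language.BoundedFormula.IsQF B} {S₁ S₂ : Stmt L V ar}
      {σ τ : V → M} : B.Realize σ → Exec D S₁ σ τ → Exec D (.cond B hB S₁ S₂) σ τ
  | condFalse {B : L.Formula V} {hB : FirstOrder.Language.BoundedFormula.IsQF B} {S₁ S₂ : Stmt L V ar}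
      {σ τ : V → M} : ¬ B.Realize σ → Exec D S₂ σ τ → Exec D (.cond B hB S₁ S₂) σ τ
  | loopTrue {B : L.Formula V} {hB : FirstOrder.Language.BoundedFormula.IsQF B} {S : Stmt L V ar}
      {σ ρ τ : V → M} :
      B.Realize σ → Exec D S σ ρ → Exec D (.loop B hB S) ρ τ → Exec D (.loop B hB S) σ τ
  | loopFalse {B : L.Formula V} {hB : FirstOrder.Language.BoundedFormula.IsQF B} {S : Stmt L V ar}
      {σ : V → M} : ¬ B.Realize σ → Exec D (.loop B hB S) σ σ
  | block {n : ℕ} {xs : Fin n ↪ V} {t : Fin n → L.Term V} {S : Stmt L V ar} {σ τ : V → M} :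
      Exec D (.seq (.assign xs t) S) σ τ →
        Exec D (.block xs t S) σ (update τ xs fun i => σ (xs i))

/-- The meaning `⟦p⟧` of an assertion: the set of states in which it is true. -/
def meaning (M : Type y) [L.Structure M] (p : L.Formula V) : Set (V → M) :=
  {σ | p.Realize σ}

/-- The assertion `p` is true in the interpretation with domain `M`. -/
def TrueIn (M : Type y) [L.Structure M] (p : L.Formula V) : Prop :=
  meaning M p = Set.univ

/-- The strongest postcondition of `(D | S)` with respect to `p`: the set of states that can be
reached by executing `(D | S)` from a state that satisfies `p`. -/
def sp (M : Type y) [L.Structure M] (D : Decls L V ar) (p : L.Formula V) (S : Stmt L V ar) :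
    Set (V → M) :=
  {τ | ∃ σ ∈ meaning M p, Exec D S σ τ}

/-- The language is expressive relative to the interpretation with domain `M`, for programs with
declarations `D`: all strongest postconditions are definable. -/
def Expressive (M : Type y) [L.Structure M] (D : Decls L V ar) : Prop :=
  ∀ (p : L.Formula V) (S : Stmt L V ar), ∃ φ : L.Formula V, meaning M φ = sp M D p S

end Semantics

/-! ### Correctness formulas and the proof system -/

/-- A correctness formula `{p} S {q}`. -/
structure Triple (L : FirstOrder.Language.{u, v}) (V : Type w) {Proc : Type x} (ar : Proc → ℕ) where
  /-- the precondition -/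
  pre : L.Formula V
  /-- the statement -/
  stmt : Stmt L V ar
  /-- the postcondition -/
  post : L.Formula V

section ProofSystem

variable {L : FirstOrder.Language.{u, v}} {V : Type w} {Proc : Type x} {ar : Proc → ℕ}

/-- `{p} S {q}` is true in the interpretation with domain `M`, in the sense of partial
correctness. -/
def Valid (M : Type y) [L.Structure M] (D : Decls L V ar) (f : Triple L V ar) : Prop :=
  sp M D f.pre f.stmt ⊆ meaning M f.post

variable [DecidableEq V]

/-- Provability from the set `Φ` of correctness formulas, and from all assertions that are true in
the interpretation with domain `M`, by all axioms and rules of CBV except RECURSION. -/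
inductive DerivesBasic (M : Type y) [L.Structure M] (D : Decls L V ar) (Φ : Set (Triple L V ar)) :
    Triple L V ar → Prop
  | hyp {f : Triple L V ar} : f ∈ Φ → DerivesBasic M D Φ f
  | skip (p : L.Formula V) : DerivesBasic M D Φ ⟨p, .skip, p⟩
  | assign {n : ℕ} (xs : Fin n ↪ V) (t : Fin n → L.Term V) (p : L.Formula V) :
      DerivesBasic M D Φ ⟨subst p xs t, .assign xs t, p⟩
  | seq {p r q : L.Formula V} {S₁ S₂ : Stmt L V ar} :
      DerivesBasic M D Φ ⟨p, S₁, r⟩ → DerivesBasic M D Φ ⟨r, S₂, q⟩ →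
        DerivesBasic M D Φ ⟨p, .seq S₁ S₂, q⟩
  | cond {p q B : L.Formula V} {hB : FirstOrder.Language.BoundedFormula.IsQF B} {S₁ S₂ : Stmt L V ar} :
      DerivesBasic M D Φ ⟨p ⊓ B, S₁, q⟩ → DerivesBasic M D Φ ⟨p ⊓ B.not, S₂, q⟩ →
        DerivesBasic M D Φ ⟨p, .cond B hB S₁ S₂, q⟩
  | loop {p B : L.Formula V} {hB : FirstOrder.Language.BoundedFormula.IsQF B} {S : Stmt L V ar} :
      DerivesBasic M D Φ ⟨p ⊓ B, S, p⟩ → DerivesBasic M D Φ ⟨p, .loop B hB S, p ⊓ B.not⟩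
  | procedureCall {p q : L.Formula V} {P : Proc} (t : Fin (ar P) → L.Term V) :
      Disjoint (Set.range (D.formals P)) (free q) →
      DerivesBasic M D Φ ⟨p, genericCall D P, q⟩ →
        DerivesBasic M D Φ ⟨subst p (D.formals P) t, .call P t, q⟩
  | block {n : ℕ} {xs : Fin n ↪ V} {t : Fin n → L.Term V} {S : Stmt L V ar} {p q : L.Formula V} :
      Disjoint (Set.range xs) (free q) →
      DerivesBasic M D Φ ⟨p, .seq (.assign xs t) S, q⟩ →
        DerivesBasic M D Φ ⟨p, .block xs t S, q⟩
  | substitution {n : ℕ} (xs : Fin n ↪ V) (ys : Fin n → V) {p q : L.Formula V}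
      {S : Stmt L V ar} :
      Disjoint (Set.range xs) (progVars D S) → Disjoint (Set.range ys) (change D S) →
      DerivesBasic M D Φ ⟨p, S, q⟩ →
        DerivesBasic M D Φ ⟨subst p xs fun i => FirstOrder.Language.Term.var (ys i), S,
          subst q xs fun i => FirstOrder.Language.Term.var (ys i)⟩
  | invariance (p : L.Formula V) {r q : L.Formula V} {S : Stmt L V ar} :
      Disjoint (free p) (change D S) →
      DerivesBasic M D Φ ⟨r, S, q⟩ → DerivesBasic M D Φ ⟨p ⊓ r, S, p ⊓ q⟩
  | existsIntro {n : ℕ} (xs : Fin n ↪ V) {p q : L.Formula V} {S : Stmt L V ar} :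
      Disjoint (Set.range xs) (progVars D S ∪ free q) →
      DerivesBasic M D Φ ⟨p, S, q⟩ → DerivesBasic M D Φ ⟨existsVars xs p, S, q⟩
  | consequence {p p₁ q₁ q : L.Formula V} {S : Stmt L V ar} :
      TrueIn M (p.imp p₁) → DerivesBasic M D Φ ⟨p₁, S, q₁⟩ → TrueIn M (q₁.imp q) →
        DerivesBasic M D Φ ⟨p, S, q⟩

/-- `f` is the conclusion of an application of the RECURSION rule: for some specifications
`{p i} P i (ū i) {q i}` of the generic calls of all the declared procedures, where `ū i` is not free
in `q i`, the formula `f` and the formulas `{p i} S i {q i}` for the procedure bodies `S i` are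
provable from these specifications by the remaining axioms and rules. -/
def RecursionConclusion (M : Type y) [L.Structure M] (D : Decls L V ar) (f : Triple L V ar) :
    Prop :=
  ∃ p q : Proc → L.Formula V,
    (∀ i, Disjoint (Set.range (D.formals i)) (free (q i))) ∧
    DerivesBasic M D (Set.range fun i => ⟨p i, genericCall D i, q i⟩) f ∧
    ∀ i, DerivesBasic M D (Set.range fun j => ⟨p j, genericCall D j, q j⟩) ⟨p i, D.body i, q i⟩

/-- `Φ ⊢_I f`: provability in the system CBV (including the RECURSION rule) from the set `Φ` of
correctness formulas and all assertions true in the interpretation with domain `M`. -/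
def Derives (M : Type y) [L.Structure M] (D : Decls L V ar) (Φ : Set (Triple L V ar))
    (f : Triple L V ar) : Prop :=
  DerivesBasic M D (Φ ∪ {g | RecursionConclusion M D g}) f

end ProofSystem

end

end CBV

/-!
Write `{x̄ = z̄} S {φ}` for the most general correctness formula of `S`, where `x̄` are the
variables that `S` can change, the fresh variables `z̄` store their initial values, and `φ` defines
the strongest postcondition of `x̄ = z̄`. Since the other variables keep their values, `φ` defines
the input-output relation of `S`.

* Hence weakest liberal preconditions are definable, and the weakest liberal precondition of a
  loop is a loop invariant.
* Every valid `{p} S {q}` follows from the most general formula: rename `z̄` to variables `ȳ` that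
  do not occur in `p` and `q`, add `p[x̄ := ȳ]` by INVARIANCE, and remove the conjunct `x̄ = ȳ`
  of the precondition by ∃-INTRODUCTION.
* BLOCK and PROCEDURE CALL require that the local variables are not free in the postcondition.
  Since their initial values are restored, fresh variables with these values can replace them in
  the postcondition, and INVARIANCE together with ∃-INTRODUCTION removes the fresh variables.

The RECURSION rule is applied to the most general formulas of the generic calls, with the formal
parameters in the postcondition replaced in this way.
-/

namespace CBV

open FirstOrder.Language Set

section States

variable {V : Type w} {M : Type y} {n m : ℕ}

@[simp]
theorem update_apply (σ : V → M) (xs : Fin n ↪ V) (d : Fin n → M) (i : Fin n) :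
    update σ xs d (xs i) = d i :=
  xs.injective.extend_apply d σ i

theorem update_comp (σ : V → M) (xs : Fin n ↪ V) (d : Fin n → M) : update σ xs d ∘ xs = d :=
  funext (update_apply σ xs d)

theorem update_of_notMem (σ : V → M) {xs : Fin n ↪ V} (d : Fin n → M) {a : V}
    (ha : a ∉ range xs) : update σ xs d a = σ a :=
  Function.extend_apply' d σ a ha

theorem update_eq_of_eqOn_compl {σ τ : V → M} {xs : Fin n ↪ V} (h : EqOn σ τ (range xs)ᶜ) :
    update σ xs (τ ∘ xs) = τ := by
  funext a
  by_cases ha : a ∈ range xs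
  · obtain ⟨i, rfl⟩ := ha
    exact update_apply σ xs _ i
  · exact (update_of_notMem σ _ ha).trans (h ha)

theorem update_self (σ : V → M) (xs : Fin n ↪ V) : update σ xs (σ ∘ xs) = σ :=
  update_eq_of_eqOn_compl fun _ _ => rfl

theorem update_update (σ : V → M) (xs : Fin n ↪ V) (d e : Fin n → M) :
    update (update σ xs d) xs e = update σ xs e := by
  funext a
  by_cases ha : a ∈ range xs
  · obtain ⟨i, rfl⟩ := ha
    simp only [update_apply]
  · simp only [update_of_notMem _ _ ha]

theorem update_comp_of_disjoint (σ : V → M) {xs : Fin n ↪ V} (d : Fin n → M) {ys : Fin m → V}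
    (h : Disjoint (range ys) (range xs)) : update σ xs d ∘ ys = σ ∘ ys :=
  funext fun i => update_of_notMem σ d (disjoint_left.1 h (mem_range_self i))

theorem update_comm (σ : V → M) {xs : Fin n ↪ V} {ys : Fin m ↪ V}
    (h : Disjoint (range xs) (range ys)) (d : Fin n → M) (e : Fin m → M) :
    update (update σ xs d) ys e = update (update σ ys e) xs d := by
  funext a
  by_cases ha : a ∈ range xs
  · have hy : a ∉ range ys := disjoint_left.1 h ha
    obtain ⟨i, rfl⟩ := ha
    simp only [update_of_notMem _ _ hy, update_apply]
  by_cases hy : a ∈ range ys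
  · obtain ⟨i, rfl⟩ := hy
    simp only [update_of_notMem _ _ ha, update_apply]
  · simp only [update_of_notMem _ _ ha, update_of_notMem _ _ hy]

theorem exists_fresh_embedding [Infinite V] {A : Set V} (hA : A.Finite) (n : ℕ) :
    ∃ zs : Fin n ↪ V, Disjoint (range zs) A :=
  ⟨(Fin.valEmbedding.trans (hA.infinite_compl.natEmbedding _)).trans (.subtype _), by
    rw [← subset_compl_iff_disjoint_right]
    rintro _ ⟨i, rfl⟩
    exact Subtype.prop _⟩

end States

section Assertions

variable {L : FirstOrder.Language.{u, v}} {V : Type w} {M : Type y} {n : ℕ}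

/-- The assertion `p[x̄ := ȳ]`, where a list `ȳ` of variables is substituted for `x̄`. -/
noncomputable abbrev rename (p : L.Formula V) (xs : Fin n ↪ V) (ys : Fin n → V) : L.Formula V :=
  subst p xs fun i => .var (ys i)

/-- The assertion `x̄ = ȳ`, that is, the conjunction of the equations between corresponding
variables of the two lists; it is used to store the values of `x̄` in the fresh variables `ȳ`. -/
noncomputable def varsEq (L : FirstOrder.Language.{u, v}) (xs ys : Fin n → V) : L.Formula V :=
  Formula.iInf fun i => (Term.var (xs i)).equal (.var (ys i))

section FreeVariables

variable [DecidableEq V]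

theorem varFinset_relabel_inl {β : Type*} (t : L.Term V) :
    (t.relabel (Sum.inl : V → V ⊕ β)).varFinsetLeft = t.varFinset := by
  induction t with
  | var => rfl
  | func f ts ih => simp only [Term.relabel, Term.varFinsetLeft, Term.varFinset, ih]

theorem varFinsetLeft_subst {β : Type*} (t : L.Term (V ⊕ β)) (f : V → L.Term V) :
    (t.subst (Sum.elim (Term.relabel Sum.inl ∘ f) (Term.var ∘ Sum.inr))).varFinsetLeft =
      t.varFinsetLeft.biUnion fun a => (f a).varFinset := by
  induction t with
  | var a => cases a <;> simp [varFinset_relabel_inl]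
  | func g ts ih => simp only [Term.subst, Term.varFinsetLeft, ih, Finset.biUnion_biUnion]

theorem freeVarFinset_subst (φ : L.BoundedFormula V n) (f : V → L.Term V) :
    (φ.subst f).freeVarFinset = φ.freeVarFinset.biUnion fun a => (f a).varFinset := by
  simp only [BoundedFormula.subst]
  induction φ with
  | falsum => rfl
  | equal t₁ t₂ =>
    simp only [BoundedFormula.mapTermRel, BoundedFormula.freeVarFinset, varFinsetLeft_subst,
      Finset.union_biUnion]
  | rel R ts =>
    simp only [BoundedFormula.mapTermRel, BoundedFormula.freeVarFinset, varFinsetLeft_subst,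
      Finset.biUnion_biUnion]
  | imp φ ψ ihφ ihψ =>
    simp only [BoundedFormula.mapTermRel, BoundedFormula.freeVarFinset, ihφ, ihψ,
      Finset.union_biUnion]
  | all _ ih => exact ih

theorem free_rename (p : L.Formula V) (xs : Fin n ↪ V) (ys : Fin n → V) :
    free (rename p xs ys) ⊆ (free p \ range xs) ∪ range ys := by
  intro b hb
  simp only [free, rename, subst, freeVarFinset_subst, Finset.coe_biUnion, mem_iUnion₂] at hb
  obtain ⟨a, ha, hb⟩ := hb
  by_cases hax : a ∈ range xs
  · obtain ⟨i, rfl⟩ := hax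
    rw [substMap, xs.injective.extend_apply] at hb
    exact Or.inr ⟨i, (Finset.mem_singleton.1 hb).symm⟩
  · rw [substMap, Function.extend_apply' _ _ _ hax] at hb
    obtain rfl : b = a := Finset.mem_singleton.1 hb
    exact Or.inl ⟨ha, hax⟩

theorem disjoint_free_rename {xs : Fin n ↪ V} {ys : Fin n → V}
    (h : Disjoint (range ys) (range xs)) (p : L.Formula V) :
    Disjoint (range xs) (free (rename p xs ys)) :=
  (disjoint_sdiff_right.union_right h.symm).mono_right (free_rename p xs ys)

theorem free_inf (p q : L.Formula V) : free (p ⊓ q) = free p ∪ free q := by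
  change (((p.freeVarFinset ∪ (q.freeVarFinset ∪ ∅)) ∪ ∅ : Finset V) : Set V) = _
  simp only [Finset.union_empty, Finset.coe_union, free]

theorem free_iInf {β : Type*} [Finite β] (f : β → L.Formula V) :
    free (Formula.iInf f) ⊆ ⋃ b, free (f b) := by
  suffices h : ∀ l : List β,
      free ((l.map f).foldr (· ⊓ ·) (⊤ : L.BoundedFormula V 0)) ⊆ ⋃ b, free (f b) from h _
  intro l
  induction l with
  | nil => exact (Finset.coe_empty.trans_subset (empty_subset _) :)
  | cons b l ih =>
    exact (free_inf _ _).trans_subset (union_subset (subset_iUnion (fun b => free (f b)) b) ih)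

theorem free_varsEq (xs ys : Fin n → V) : free (varsEq L xs ys) ⊆ range xs ∪ range ys := by
  refine (free_iInf _).trans (iUnion_subset fun i a ha => ?_)
  have : a = xs i ∨ a = ys i := by
    simpa [free, Term.equal, Term.bdEqual, BoundedFormula.freeVarFinset] using ha
  exact this.imp (fun h => ⟨i, h.symm⟩) fun h => ⟨i, h.symm⟩

theorem finite_free (p : L.Formula V) : (free p).Finite := Finset.finite_toSet _

theorem finite_termVars (t : Fin n → L.Term V) : (termVars t).Finite :=
  finite_iUnion fun _ => Finset.finite_toSet _

end FreeVariables

section Realize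

variable [L.Structure M]

theorem realize_varsEq {xs ys : Fin n → V} {σ : V → M} :
    (varsEq L xs ys).Realize σ ↔ σ ∘ xs = σ ∘ ys := by
  simp [varsEq, funext_iff]

theorem realize_subst (p : L.Formula V) (xs : Fin n ↪ V) (t : Fin n → L.Term V) {σ : V → M} :
    (subst p xs t).Realize σ ↔ p.Realize (update σ xs fun i => (t i).realize σ) := by
  have h (a : V) : (substMap xs t a).realize σ = update σ xs (fun i => (t i).realize σ) a :=
    Function.apply_extend (fun t : L.Term V => t.realize σ) xs Term.var a
  simp only [Formula.Realize, subst, BoundedFormula.realize_subst, h]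

theorem realize_rename (p : L.Formula V) (xs : Fin n ↪ V) (ys : Fin n → V) {σ : V → M} :
    (rename p xs ys).Realize σ ↔ p.Realize (update σ xs (σ ∘ ys)) :=
  realize_subst p xs _

theorem realize_rename_of_comp_eq (p : L.Formula V) {xs : Fin n ↪ V} {ys : Fin n → V} {σ : V → M}
    (h : σ ∘ xs = σ ∘ ys) : (rename p xs ys).Realize σ ↔ p.Realize σ := by
  rw [realize_rename, ← h, update_self]

theorem realize_existsVars (xs : Fin n ↪ V) (p : L.Formula V) {σ : V → M} :
    (existsVars xs p).Realize σ ↔ ∃ d, p.Realize (update σ xs d) := by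
  have h (d : Fin n → M) :
      Sum.elim σ (d ∘ Fin.castAdd 0) ∘ Function.extend xs Sum.inr Sum.inl = update σ xs d :=
    funext fun a => Function.apply_extend (Sum.elim σ (d ∘ Fin.castAdd 0)) xs Sum.inl a
  rw [existsVars, BoundedFormula.realize_exs]
  refine exists_congr fun d => ?_
  rw [BoundedFormula.realize_relabel, h, Formula.Realize, Subsingleton.elim (d ∘ _) default]

variable [DecidableEq V]

theorem realize_update_of_disjoint {p : L.Formula V} {xs : Fin n ↪ V}
    (h : Disjoint (range xs) (free p)) (σ : V → M) (d : Fin n → M) :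
    p.Realize (update σ xs d) ↔ p.Realize σ := by
  rw [Formula.Realize, ← BoundedFormula.realize_restrictFreeVar (f := Subtype.val) (v := σ)
    (update σ xs d) fun a => (update_of_notMem σ d (disjoint_right.1 h a.2)).symm]
  exact BoundedFormula.realize_restrictFreeVar σ fun _ => rfl

theorem realize_comp_update_of_disjoint {m : ℕ} {t : Fin m → L.Term V} {xs : Fin n ↪ V}
    (h : Disjoint (range xs) (termVars t)) (σ : V → M) (d : Fin n → M) :
    (fun i => (t i).realize (update σ xs d)) = fun i => (t i).realize σ := by
  funext i
  rw [← Term.realize_restrictVar (f := Subtype.val) (v := σ) (update σ xs d) fun a =>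
    (update_of_notMem σ d (disjoint_right.1 h (mem_iUnion.2 ⟨i, a.2⟩))).symm]
  exact Term.realize_restrictVar σ fun _ => rfl

end Realize

end Assertions

section Programs

variable {L : FirstOrder.Language.{u, v}} {V : Type w} {Proc : Type x} {ar : Proc → ℕ}

theorem changeWith_subset_union (c : Proc → Set V) (S : Stmt L V ar) :
    S.changeWith c ⊆ S.changeWith (fun _ => ∅) ∪ ⋃ P, c P := by
  induction S with
  | skip => exact subset_union_left
  | assign xs t => exact subset_union_left
  | call P t => exact (subset_iUnion c P).trans subset_union_right
  | seq S₁ S₂ h₁ h₂ =>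
    exact (union_subset_union h₁ h₂).trans_eq (union_union_distrib_right _ _ _).symm
  | cond B hB S₁ S₂ h₁ h₂ =>
    exact (union_subset_union h₁ h₂).trans_eq (union_union_distrib_right _ _ _).symm
  | loop _ _ _ h => exact h
  | block xs t S h => exact fun a ha => (h ha.1).imp_left fun h => ⟨h, ha.2⟩

theorem change_body_subset (D : Decls L V ar) (P : Proc) : change D (D.body P) ⊆ changeDecls D :=
  (changeWith_subset_union _ _).trans <| union_subset
    (subset_iUnion (fun P => (D.body P).changeWith fun _ => ∅) P)
    (iUnion_subset fun _ => sdiff_subset)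

variable [DecidableEq V]

/-- `var(D)`, the set of variables that occur in the procedure declarations, so that
`var(D | S)` is the union of `declVars D` and `S.vars`. -/
def declVars (D : Decls L V ar) : Set V :=
  ⋃ P, range (D.formals P) ∪ (D.body P).vars

theorem range_formals_subset (D : Decls L V ar) (P : Proc) : range (D.formals P) ⊆ declVars D :=
  subset_union_left.trans (subset_iUnion (fun P => range (D.formals P) ∪ (D.body P).vars) P)

theorem vars_body_subset (D : Decls L V ar) (P : Proc) : (D.body P).vars ⊆ declVars D :=
  subset_union_right.trans (subset_iUnion (fun P => range (D.formals P) ∪ (D.body P).vars) P)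

theorem changeWith_empty_subset_vars (S : Stmt L V ar) :
    S.changeWith (fun _ => ∅) ⊆ S.vars := by
  induction S with
  | skip => exact Subset.rfl
  | assign xs t => exact subset_union_left
  | call P t => exact empty_subset _
  | seq S₁ S₂ h₁ h₂ => exact union_subset_union h₁ h₂
  | cond B _ S₁ S₂ h₁ h₂ => exact union_subset_union (h₁.trans subset_union_right) h₂
  | loop B hB S h => exact h.trans subset_union_right
  | block xs t S h => exact sdiff_subset.trans (h.trans subset_union_right)

theorem changeDecls_subset (D : Decls L V ar) : changeDecls D ⊆ declVars D :=
  iUnion_mono fun _ => (changeWith_empty_subset_vars _).trans subset_union_right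

theorem change_subset_progVars (D : Decls L V ar) (S : Stmt L V ar) :
    change D S ⊆ progVars D S :=
  (changeWith_subset_union _ _).trans <| union_subset
    ((changeWith_empty_subset_vars S).trans subset_union_right)
    (iUnion_subset fun _ => (sdiff_subset.trans (changeDecls_subset D)).trans subset_union_left)

theorem progVars_genericCall (D : Decls L V ar) (P : Proc) :
    progVars D (genericCall D P) = declVars D := by
  refine union_eq_self_of_subset_right (iUnion_subset fun i a ha => ?_)
  obtain rfl : a = D.formals P i := Finset.mem_singleton.1 ha
  exact range_formals_subset D P (mem_range_self i)

theorem finite_vars (S : Stmt L V ar) : S.vars.Finite := by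
  induction S with
  | skip => exact finite_empty
  | assign xs t => exact (finite_range _).union (finite_termVars t)
  | call P t => exact finite_termVars t
  | seq S₁ S₂ h₁ h₂ => exact h₁.union h₂
  | cond B _ S₁ S₂ h₁ h₂ => exact ((finite_free B).union h₁).union h₂
  | loop B _ S h => exact (finite_free B).union h
  | block xs t S h => exact ((finite_range _).union (finite_termVars t)).union h

theorem finite_progVars [Finite Proc] (D : Decls L V ar) (S : Stmt L V ar) :
    (progVars D S).Finite :=
  (finite_iUnion fun _ => (finite_range _).union (finite_vars _)).union (finite_vars S)

end Programs

section Executions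

variable {L : FirstOrder.Language.{u, v}} {V : Type w} {Proc : Type x} {ar : Proc → ℕ}
variable {M : Type y} [L.Structure M] {D : Decls L V ar} {S : Stmt L V ar} {σ τ : V → M} {n : ℕ}

theorem exec_block_iff {xs : Fin n ↪ V} {t : Fin n → L.Term V} :
    Exec D (.block xs t S) σ τ ↔
      ∃ ρ, Exec D S (update σ xs fun i => (t i).realize σ) ρ ∧ τ = update ρ xs (σ ∘ xs) := by
  constructor
  · exact fun | .block (.seq (.assign ..) h) => ⟨_, h, rfl⟩
  · rintro ⟨ρ, h, rfl⟩
    exact .block (.seq (.assign _ _ _) h)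

theorem exec_genericCall_iff {P : Proc} :
    Exec D (genericCall D P) σ τ ↔
      ∃ ρ, Exec D (D.body P) σ ρ ∧ τ = update ρ (D.formals P) (σ ∘ D.formals P) := by
  have h : Exec D (genericCall D P) σ τ ↔
      Exec D (.block (D.formals P) (fun i => .var (D.formals P i)) (D.body P)) σ τ :=
    ⟨fun h => by cases h; assumption, .call⟩
  have hu : (update σ (D.formals P) fun i => σ (D.formals P i)) = σ := update_self _ _
  simp only [h, exec_block_iff, Term.realize_var, hu]

theorem Exec.call_of_genericCall {P : Proc} {t : Fin (ar P) → L.Term V}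
    (h : Exec D (genericCall D P) (update σ (D.formals P) fun i => (t i).realize σ) τ) :
    Exec D (.call P t) σ (update τ (D.formals P) (σ ∘ D.formals P)) := by
  obtain ⟨ρ, hρ, rfl⟩ := exec_genericCall_iff.1 h
  rw [update_update]
  exact .call (exec_block_iff.2 ⟨ρ, hρ, rfl⟩)

theorem Exec.eqOn_compl_change (h : Exec D S σ τ) : EqOn σ τ (change D S)ᶜ := by
  induction h with
  | skip => exact fun _ _ => rfl
  | assign xs t σ => exact fun a ha => (update_of_notMem _ _ ha).symm
  | call _ ih => exact fun a ha => ih fun h => ha ⟨change_body_subset D _ h.1, h.2⟩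
  | seq _ _ ih₁ ih₂ =>
    exact fun a ha => (ih₁ fun h => ha (Or.inl h)).trans (ih₂ fun h => ha (Or.inr h))
  | condTrue _ _ ih => exact fun a ha => ih fun h => ha (Or.inl h)
  | condFalse _ _ ih => exact fun a ha => ih fun h => ha (Or.inr h)
  | loopTrue _ _ _ ih₁ ih₂ => exact fun a ha => (ih₁ ha).trans (ih₂ ha)
  | loopFalse => exact fun _ _ => rfl
  | @block n xs t S σ τ _ ih =>
    intro a ha
    by_cases hax : a ∈ range xs
    · obtain ⟨i, rfl⟩ := hax
      simp only [update_apply]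
    · rw [update_of_notMem _ _ hax]
      exact ih fun h => ha ⟨h.resolve_left hax, hax⟩

variable [DecidableEq V] {zs : Fin n ↪ V}

theorem Exec.comp_eq (h : Exec D S σ τ) {ys : Fin n → V}
    (hys : Disjoint (range ys) (progVars D S)) : σ ∘ ys = τ ∘ ys :=
  funext fun i => h.eqOn_compl_change fun hi =>
    disjoint_left.1 hys (mem_range_self i) (change_subset_progVars D S hi)

theorem Exec.update_of_disjoint (h : Exec D S σ τ) (hzs : Disjoint (range zs) (progVars D S))
    (d : Fin n → M) : Exec D S (update σ zs d) (update τ zs d) := by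
  obtain ⟨hD, hS⟩ := disjoint_union_right.1 hzs
  clear hzs
  induction h with
  | skip => exact .skip _
  | assign xs t σ =>
    obtain ⟨hxs, ht⟩ := disjoint_union_right.1 hS
    rw [update_comm _ hxs.symm, ← realize_comp_update_of_disjoint ht σ d]
    exact .assign xs t _
  | @call P t σ τ _ ih =>
    exact .call <| ih <| ((hD.mono_right (range_formals_subset D P)).union_right hS).union_right
      (hD.mono_right (vars_body_subset D P))
  | seq _ _ ih₁ ih₂ =>
    obtain ⟨hS₁, hS₂⟩ := disjoint_union_right.1 hS
    exact .seq (ih₁ hS₁) (ih₂ hS₂)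
  | condTrue hB _ ih =>
    obtain ⟨hfree, hS₁⟩ := disjoint_union_right.1 (disjoint_union_right.1 hS).1
    exact .condTrue ((realize_update_of_disjoint hfree _ d).2 hB) (ih hS₁)
  | condFalse hB _ ih =>
    obtain ⟨hfree, hS₂⟩ := disjoint_union_right.1 hS
    exact .condFalse (mt (realize_update_of_disjoint
      (disjoint_union_right.1 hfree).1 _ d).1 hB) (ih hS₂)
  | loopTrue hB _ _ ih₁ ih₂ =>
    obtain ⟨hfree, hbody⟩ := disjoint_union_right.1 hS
    exact .loopTrue ((realize_update_of_disjoint hfree _ d).2 hB) (ih₁ hbody) (ih₂ hS)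
  | loopFalse hB =>
    exact .loopFalse (mt (realize_update_of_disjoint (disjoint_union_right.1 hS).1 _ d).1 hB)
  | @block n xs t S σ τ _ ih =>
    have hxs : Disjoint (range xs) (range zs) :=
      (disjoint_union_right.1 (disjoint_union_right.1 hS).1).1.symm
    have hb := Exec.block (ih hS)
    change Exec D (.block xs t S) _ (update _ xs (update σ zs d ∘ xs)) at hb
    rwa [update_comp_of_disjoint σ d hxs, update_comm _ hxs.symm] at hb

theorem exec_update_iff (hzs : Disjoint (range zs) (progVars D S)) (h : σ ∘ zs = τ ∘ zs)
    {d : Fin n → M} : Exec D S (update σ zs d) (update τ zs d) ↔ Exec D S σ τ := by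
  refine ⟨fun he => ?_, fun he => he.update_of_disjoint hzs d⟩
  have he' := he.update_of_disjoint hzs (σ ∘ zs)
  rwa [update_update, update_update, update_self, h, update_self] at he'

end Executions

section Definability

variable {L : FirstOrder.Language.{u, v}} {V : Type w} {Proc : Type x} {ar : Proc → ℕ}
variable {M : Type y} [L.Structure M] {D : Decls L V ar} {S : Stmt L V ar}

theorem valid_iff {p q : L.Formula V} :
    Valid M D ⟨p, S, q⟩ ↔ ∀ σ τ : V → M, p.Realize σ → Exec D S σ τ → q.Realize τ :=
  ⟨fun h σ _ hσ he => h ⟨σ, hσ, he⟩, fun h τ ⟨σ, hσ, he⟩ => h σ τ hσ he⟩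

/-- The weakest liberal precondition of `(D | S)` with respect to `q`: the set of states from which
every terminating execution of `(D | S)` ends in a state that satisfies `q`. -/
def wlp (M : Type y) [L.Structure M] (D : Decls L V ar) (S : Stmt L V ar) (q : L.Formula V) :
    Set (V → M) :=
  {σ | ∀ τ, Exec D S σ τ → q.Realize τ}

section Graph

variable [DecidableEq V]

/-- The assertion `φ` defines the input-output relation of `(D | S)`: the list `xs` enumerates the
variables that `(D | S)` can change, the fresh variables `zs` stand for their initial values, and
the final values are those of `xs` themselves. The other variables have the same initial and final
values, so the initial state is the final one with `xs` set back. -/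
structure IsGraph (M : Type y) [L.Structure M] (D : Decls L V ar) (S : Stmt L V ar) {n : ℕ}
    (xs zs : Fin n ↪ V) (φ : L.Formula V) : Prop where
  range_eq : range xs = change D S
  disjoint : Disjoint (range zs) (progVars D S)
  realize_update_iff (τ : V → M) (d : Fin n → M) :
    φ.Realize (update τ zs d) ↔ Exec D S (update τ xs d) τ

theorem exists_isGraph [Infinite V] [Finite Proc] (hexp : Expressive M D) (S : Stmt L V ar)
    {A : Set V} (hA : A.Finite) : ∃ (n : ℕ) (xs zs : Fin n ↪ V) (φ : L.Formula V),
      IsGraph M D S xs zs φ ∧ Disjoint (range zs) A := by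
  have hfin := finite_progVars D S
  obtain ⟨n, xs, hxs⟩ := (hfin.subset (change_subset_progVars D S)).fin_embedding
  obtain ⟨zs, hzs⟩ := exists_fresh_embedding (hfin.union hA) n
  obtain ⟨hzS, hzA⟩ := disjoint_union_right.1 hzs
  have hzx : Disjoint (range zs) (range xs) :=
    hzS.mono_right (hxs.trans_subset (change_subset_progVars D S))
  obtain ⟨φ, hφ⟩ := hexp (varsEq L xs zs) S
  refine ⟨n, xs, zs, φ, ⟨hxs, hzS, fun τ d => ?_⟩, hzA⟩
  have hunfold : φ.Realize (update τ zs d) ↔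
      ∃ σ, σ ∘ xs = σ ∘ zs ∧ Exec D S σ (update τ zs d) := by
    simp only [← realize_varsEq (L := L)]
    exact Set.ext_iff.1 hφ _
  rw [hunfold, ← exec_update_iff (d := d) hzS (update_comp_of_disjoint τ d hzx)]
  constructor
  · rintro ⟨σ, hσ, he⟩
    have hinit : σ = update (update τ zs d) xs (σ ∘ xs) :=
      (update_eq_of_eqOn_compl (hxs ▸ he.eqOn_compl_change.symm)).symm
    rw [hσ, he.comp_eq hzS, update_comp, update_comm _ hzx] at hinit
    exact hinit ▸ he
  · refine fun he => ⟨_, ?_, he⟩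
    rw [update_comp_of_disjoint _ d hzx.symm, update_comp, update_comp]

theorem IsGraph.disjoint_range {n : ℕ} {xs zs : Fin n ↪ V} {φ : L.Formula V}
    (hφ : IsGraph M D S xs zs φ) : Disjoint (range xs) (range zs) :=
  (hφ.disjoint.mono_right (hφ.range_eq.trans_subset (change_subset_progVars D S))).symm

theorem IsGraph.valid {n : ℕ} {xs zs : Fin n ↪ V} {φ : L.Formula V}
    (hφ : IsGraph M D S xs zs φ) : Valid M D ⟨varsEq L xs zs, S, φ⟩ := by
  refine valid_iff.2 fun σ τ hσ he => ?_
  rw [← update_self τ zs, hφ.realize_update_iff, ← he.comp_eq hφ.disjoint,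
    ← realize_varsEq.1 hσ, update_eq_of_eqOn_compl (hφ.range_eq ▸ he.eqOn_compl_change.symm)]
  exact he

end Graph

theorem exists_meaning_eq_wlp [Infinite V] [Finite Proc] (hexp : Expressive M D)
    (S : Stmt L V ar) (q : L.Formula V) : ∃ r : L.Formula V, meaning M r = wlp M D S q := by
  classical
  obtain ⟨n, xs, zs, φ, hφ, hzq⟩ := exists_isGraph hexp S (finite_free q)
  have hxz := hφ.disjoint_range
  -- No execution leads from the values of `xs` to values that violate `q`.
  refine ⟨rename (existsVars xs (φ ⊓ q.not)).not zs xs, Set.ext fun σ => ?_⟩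
  have hgraph (d : Fin n → M) :
      (φ ⊓ q.not).Realize (update (update σ zs (σ ∘ xs)) xs d) ↔
        Exec D S σ (update σ xs d) ∧ ¬ q.Realize (update σ xs d) := by
    rw [update_comm _ hxz.symm, Formula.realize_inf, Formula.realize_not,
      hφ.realize_update_iff, realize_update_of_disjoint hzq, update_update, update_self]
  have hr : (rename (existsVars xs (φ ⊓ q.not)).not zs xs).Realize σ ↔
      ∀ d, Exec D S σ (update σ xs d) → q.Realize (update σ xs d) := by
    rw [realize_rename, Formula.realize_not, realize_existsVars]
    simp only [hgraph, not_exists, not_and_not_right]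
  refine hr.trans ⟨fun h τ he => ?_, fun h d => h _⟩
  have hτ : update σ xs (τ ∘ xs) = τ :=
    update_eq_of_eqOn_compl (hφ.range_eq ▸ he.eqOn_compl_change)
  exact hτ ▸ h (τ ∘ xs) (hτ.symm ▸ he)

end Definability

section Derivations

variable {L : FirstOrder.Language.{u, v}} {V : Type w} [DecidableEq V] {Proc : Type x}
variable {ar : Proc → ℕ} {M : Type y} [L.Structure M] {D : Decls L V ar}
variable {Φ : Set (Triple L V ar)} {S S₁ S₂ : Stmt L V ar} {n : ℕ}

namespace DerivesBasic

theorem of_imp {p p₁ q₁ q : L.Formula V} (h : DerivesBasic M D Φ ⟨p₁, S, q₁⟩)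
    (hp : ∀ σ : V → M, p.Realize σ → p₁.Realize σ)
    (hq : ∀ τ : V → M, q₁.Realize τ → q.Realize τ) : DerivesBasic M D Φ ⟨p, S, q⟩ :=
  .consequence (eq_univ_of_forall fun σ => Formula.realize_imp.2 (hp σ)) h
    (eq_univ_of_forall fun τ => Formula.realize_imp.2 (hq τ))

theorem of_inf_varsEq {p q : L.Formula V} {xs : Fin n → V} {zs : Fin n ↪ V}
    (hzs : Disjoint (range zs) (progVars D S ∪ free p ∪ free q ∪ range xs))
    (h : DerivesBasic M D Φ ⟨p ⊓ varsEq L xs zs, S, q⟩) : DerivesBasic M D Φ ⟨p, S, q⟩ := by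
  obtain ⟨⟨⟨hS, hp⟩, hq⟩, hxs⟩ := by simpa only [disjoint_union_right] using hzs
  refine (existsIntro zs (hS.union_right hq) h).of_imp (fun σ hσ => ?_) fun _ => id
  refine (realize_existsVars zs _).2 ⟨σ ∘ xs, Formula.realize_inf.2
    ⟨(realize_update_of_disjoint hp σ _).2 hσ, realize_varsEq.2 ?_⟩⟩
  rw [update_comp_of_disjoint σ _ hxs.symm, update_comp]

theorem of_rename_post {p q : L.Formula V} {xs zs : Fin n ↪ V}
    (hxs : Disjoint (range xs) (change D S))
    (hzs : Disjoint (range zs) (progVars D S ∪ free p ∪ free q ∪ range xs))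
    (h : DerivesBasic M D Φ ⟨p ⊓ varsEq L xs zs, S, rename q xs zs⟩) :
    DerivesBasic M D Φ ⟨p, S, q⟩ := by
  have hzS : Disjoint (range zs) (change D S) := hzs.mono_right <|
    (change_subset_progVars D S).trans fun _ ha => Or.inl (Or.inl (Or.inl ha))
  have hinv := h.invariance (varsEq L xs zs)
    ((hxs.union_left hzS).mono_left (free_varsEq _ _))
  refine of_inf_varsEq hzs (hinv.of_imp (fun σ hσ => ?_) fun τ hτ => ?_)
  · exact Formula.realize_inf.2 ⟨(Formula.realize_inf.1 hσ).2, hσ⟩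
  · obtain ⟨heq, hq⟩ := Formula.realize_inf.1 hτ
    exact (realize_rename_of_comp_eq q (realize_varsEq.1 heq)).1 hq

end DerivesBasic

/-- Every valid correctness formula for the statement `S` is provable from `Φ` without the
RECURSION rule. -/
def CompleteFor (M : Type y) [L.Structure M] (D : Decls L V ar) (Φ : Set (Triple L V ar))
    (S : Stmt L V ar) : Prop :=
  ∀ p q : L.Formula V, Valid M D ⟨p, S, q⟩ → DerivesBasic M D Φ ⟨p, S, q⟩

theorem completeFor_skip : CompleteFor M D Φ .skip := fun p _ h =>
  (DerivesBasic.skip p).of_imp (fun _ => id) fun τ hτ => valid_iff.1 h τ τ hτ (.skip τ)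

theorem completeFor_assign (xs : Fin n ↪ V) (t : Fin n → L.Term V) :
    CompleteFor M D Φ (.assign xs t) := fun _ q h =>
  (DerivesBasic.assign xs t q).of_imp
    (fun σ hσ => (realize_subst q xs t).2 (valid_iff.1 h σ _ hσ (.assign xs t σ))) fun _ => id

theorem completeFor_seq (hexp : Expressive M D) (h₁ : CompleteFor M D Φ S₁)
    (h₂ : CompleteFor M D Φ S₂) : CompleteFor M D Φ (.seq S₁ S₂) := by
  intro p q h
  obtain ⟨r, hr⟩ := hexp p S₁
  refine .seq (h₁ p r hr.ge) (h₂ r q (valid_iff.2 fun ρ τ hρ he₂ => ?_))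
  obtain ⟨σ, hσ, he₁⟩ := hr.le hρ
  exact valid_iff.1 h σ τ hσ (.seq he₁ he₂)

theorem completeFor_cond {B : L.Formula V} {hB : BoundedFormula.IsQF B}
    (h₁ : CompleteFor M D Φ S₁) (h₂ : CompleteFor M D Φ S₂) :
    CompleteFor M D Φ (.cond B hB S₁ S₂) := by
  refine fun p q h => .cond (h₁ _ q (valid_iff.2 fun σ τ hσ he => ?_))
    (h₂ _ q (valid_iff.2 fun σ τ hσ he => ?_))
  · obtain ⟨hp, hB⟩ := Formula.realize_inf.1 hσ
    exact valid_iff.1 h σ τ hp (.condTrue hB he)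
  · obtain ⟨hp, hB⟩ := Formula.realize_inf.1 hσ
    exact valid_iff.1 h σ τ hp (.condFalse hB he)

section Fresh

variable [Infinite V] [Finite Proc]

theorem completeFor_loop (hexp : Expressive M D) {B : L.Formula V} {hB : BoundedFormula.IsQF B}
    (hS : CompleteFor M D Φ S) : CompleteFor M D Φ (.loop B hB S) := by
  intro p q h
  obtain ⟨inv, hinv⟩ := exists_meaning_eq_wlp hexp (.loop B hB S) q
  have hbody : Valid M D ⟨inv ⊓ B, S, inv⟩ := valid_iff.2 fun σ ρ hσ he => by
    obtain ⟨hσ, hBσ⟩ := Formula.realize_inf.1 hσ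
    exact hinv.ge fun τ he' => hinv.le hσ τ (.loopTrue hBσ he he')
  refine (DerivesBasic.loop (hS _ _ hbody)).of_imp
    (fun σ hσ => hinv.ge fun τ he => valid_iff.1 h σ τ hσ he) fun τ hτ => ?_
  obtain ⟨hτ, hBτ⟩ := Formula.realize_inf.1 hτ
  exact hinv.le hτ τ (.loopFalse hBτ)

theorem completeFor_block {xs : Fin n ↪ V} {t : Fin n → L.Term V}
    (hS : CompleteFor M D Φ (.seq (.assign xs t) S)) : CompleteFor M D Φ (.block xs t S) := by
  intro p q h
  obtain ⟨zs, hzs⟩ := exists_fresh_embedding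
    ((((finite_progVars D (.block xs t S)).union (finite_free p)).union (finite_free q)).union
      (finite_range xs)) n
  refine DerivesBasic.of_rename_post disjoint_sdiff_right hzs (.block ?_ (hS _ _ ?_))
  · exact disjoint_free_rename (disjoint_union_right.1 hzs).2 q
  · refine valid_iff.2 fun σ ρ hσ he => ?_
    obtain ⟨hp, hxz⟩ := Formula.realize_inf.1 hσ
    have hzS : Disjoint (range zs) (progVars D (.seq (.assign xs t) S)) :=
      hzs.mono_right fun _ ha => Or.inl (Or.inl (Or.inl ha))
    rw [realize_rename, ← he.comp_eq hzS, ← realize_varsEq.1 hxz]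
    exact valid_iff.1 h _ _ hp (.block he)

theorem completeFor_call (hexp : Expressive M D) {P : Proc}
    (hP : CompleteFor M D Φ (genericCall D P)) (t : Fin (ar P) → L.Term V) :
    CompleteFor M D Φ (.call P t) := by
  intro p q h
  obtain ⟨zs, hzs⟩ := exists_fresh_embedding
    ((((finite_progVars D (.call P t)).union (finite_free p)).union (finite_free q)).union
      (finite_range (D.formals P))) (ar P)
  have hzu : Disjoint (range zs) (range (D.formals P)) := (disjoint_union_right.1 hzs).2
  have hzP : Disjoint (range zs) (progVars D (genericCall D P)) :=
    progVars_genericCall D P ▸ hzs.mono_right fun _ ha => Or.inl (Or.inl (Or.inl (Or.inl ha)))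
  obtain ⟨r, hr⟩ := exists_meaning_eq_wlp hexp (genericCall D P) (rename q (D.formals P) zs)
  have hgeneric : DerivesBasic M D Φ ⟨r, genericCall D P, rename q (D.formals P) zs⟩ :=
    hP _ _ (valid_iff.2 fun σ τ hσ => hr.le hσ τ)
  refine DerivesBasic.of_rename_post disjoint_sdiff_right hzs
    ((hgeneric.procedureCall t (disjoint_free_rename hzu q)).of_imp (fun σ hσ => ?_) fun _ => id)
  obtain ⟨hp, huz⟩ := Formula.realize_inf.1 hσ
  refine (realize_subst r _ t).2 (hr.ge fun τ he => ?_)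
  rw [realize_rename, ← he.comp_eq hzP, update_comp_of_disjoint σ _ hzu, ← realize_varsEq.1 huz]
  exact valid_iff.1 h _ _ hp he.call_of_genericCall

theorem completeFor_of_isGraph {xs zs : Fin n ↪ V} {φ : L.Formula V}
    (hφ : IsGraph M D S xs zs φ) (h : DerivesBasic M D Φ ⟨varsEq L xs zs, S, φ⟩) :
    CompleteFor M D Φ S := by
  intro p q hv
  obtain ⟨ys, hys⟩ := exists_fresh_embedding
    ((((finite_progVars D S).union (finite_free p)).union (finite_free q)).union
      (finite_range xs)) n
  have hyS : Disjoint (range ys) (change D S) := hys.mono_right <|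
    (change_subset_progVars D S).trans fun _ ha => Or.inl (Or.inl (Or.inl ha))
  have hxz := hφ.disjoint_range
  have hp : Disjoint (free (rename p xs ys)) (change D S) := by
    refine Disjoint.mono_left (free_rename p xs ys) (Disjoint.union_left ?_ hyS)
    exact hφ.range_eq ▸ disjoint_sdiff_left
  have hadapted := (h.substitution zs ys hφ.disjoint hyS).invariance (rename p xs ys) hp
  refine DerivesBasic.of_inf_varsEq hys (hadapted.of_imp (fun σ hσ => ?_) fun τ hτ => ?_)
  · obtain ⟨hpσ, hxy⟩ := Formula.realize_inf.1 hσ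
    rw [realize_varsEq] at hxy
    refine Formula.realize_inf.2 ⟨(realize_rename_of_comp_eq p hxy).2 hpσ, ?_⟩
    rw [realize_rename, realize_varsEq, update_comp_of_disjoint σ _ hxz, update_comp, hxy]
  · obtain ⟨hpτ, hφτ⟩ := Formula.realize_inf.1 hτ
    rw [realize_rename] at hpτ hφτ
    exact valid_iff.1 hv _ τ hpτ ((hφ.realize_update_iff τ _).1 hφτ)

theorem exists_mostGeneral_spec (hexp : Expressive M D) (P : Proc) :
    ∃ p q : L.Formula V, Disjoint (range (D.formals P)) (free q) ∧
      Valid M D ⟨p, D.body P, q⟩ ∧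
      ∀ Φ, DerivesBasic M D Φ ⟨p, genericCall D P, q⟩ → CompleteFor M D Φ (genericCall D P) := by
  obtain ⟨n, xs, zs, φ, hφ, -⟩ := exists_isGraph hexp (genericCall D P) finite_empty
  obtain ⟨ws, hws⟩ := exists_fresh_embedding
    ((((finite_progVars D (genericCall D P)).union (finite_free (varsEq L xs zs))).union
      (finite_free φ)).union (finite_range (D.formals P))) (ar P)
  have hwu : Disjoint (range ws) (range (D.formals P)) := (disjoint_union_right.1 hws).2
  have hwD : Disjoint (range ws) (progVars D (D.body P)) := hws.mono_right <|
    (union_subset Subset.rfl (vars_body_subset D P)).trans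
      fun _ ha => Or.inl (Or.inl (Or.inl (Or.inl ha)))
  refine ⟨varsEq L xs zs ⊓ varsEq L (D.formals P) ws, rename φ (D.formals P) ws,
    disjoint_free_rename hwu φ, valid_iff.2 fun σ τ hσ he => ?_,
    fun Φ h => completeFor_of_isGraph hφ (.of_rename_post disjoint_sdiff_right hws h)⟩
  obtain ⟨hxz, huw⟩ := Formula.realize_inf.1 hσ
  rw [realize_rename, ← he.comp_eq hwD, ← realize_varsEq.1 huw]
  exact valid_iff.1 hφ.valid _ _ hxz (exec_genericCall_iff.2 ⟨τ, he, rfl⟩)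

theorem completeFor_of_forall_genericCall (hexp : Expressive M D)
    (hD : ∀ P, CompleteFor M D Φ (genericCall D P)) (S : Stmt L V ar) : CompleteFor M D Φ S := by
  induction S with
  | skip => exact completeFor_skip
  | assign xs t => exact completeFor_assign xs t
  | call P t => exact completeFor_call hexp (hD P) t
  | seq S₁ S₂ h₁ h₂ => exact completeFor_seq hexp h₁ h₂
  | cond B hB S₁ S₂ h₁ h₂ => exact completeFor_cond h₁ h₂
  | loop B hB S h => exact completeFor_loop hexp h
  | block xs t S h => exact completeFor_block (completeFor_seq hexp (completeFor_assign xs t) h)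

end Fresh

end Derivations

end CBV

theorem mainTheorem1 {L : FirstOrder.Language.{u, v}} {V : Type w} [DecidableEq V] [Infinite V]
    {Proc : Type x} [Finite Proc] {ar : Proc → ℕ} (D : CBV.Decls L V ar)
    {M : Type y} [Nonempty M] [L.Structure M] (hexp : CBV.Expressive M D)
    (p : L.Formula V) (S : CBV.Stmt L V ar) (q : L.Formula V)
    (hvalid : CBV.Valid M D ⟨p, S, q⟩) :
    CBV.Derives M D ∅ ⟨p, S, q⟩ := by
  choose pre post hfree hbody hgeneral using CBV.exists_mostGeneral_spec hexp
  have hcomplete := CBV.completeFor_of_forall_genericCall hexp fun P =>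
    hgeneral P _ (.hyp (Set.mem_range_self P))
  exact .hyp (Or.inr ⟨pre, post, hfree, hcomplete S p q hvalid,
    fun P => hcomplete (D.body P) (pre P) (post P) (hbody P)⟩)
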